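/- Call a set $A\subseteq\mathbb{R}^2$ generic if no three of its points lie on a common line and no four of its points lie on a common circle. For a generic set $A$ of $n$ points in $\mathbb{R}^2$ and an integer $j\ge 0$, a $j$-facet of $A$ is a (unordered) subset $D\subseteq A$ of two points such that the line through the points of $D$ partitions $A\setminus D$ into $j$ and $n-2-j$ points on its two sides. Let $F_j(A)$ be the number of $j$-facets of $A$. Proposition 4.1. Let $A$ be a generic set of $n$ points in $\mathbb{R}^2$, and let $k$ be a non-negative integer with $k\le\frac{n-3}{3}$. Then $$\sum_{j=0}^{k}F_j(A)\le (k+1)\,n .$$ -/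

import Mathlib

noncomputable section

namespace FacetCount

/-- The hyperplane of `ℝᵈ` with normal vector `u` and offset `c` (a genuine one iff `u ≠ 0`). -/
def hyperplane {d : ℕ} (u : EuclideanSpace ℝ (Fin d)) (c : ℝ) : Set (EuclideanSpace ℝ (Fin d)) :=
  {x | inner ℝ u x = c}

/-- A set `A` in `ℝᵈ` is generic if no `d + 1` of its points lie on a common hyperplane
and no `d + 2` of its points lie on a common `(d - 1)`-sphere. -/
def Generic {d : ℕ} (A : Set (EuclideanSpace ℝ (Fin d))) : Prop :=
  (∀ T : Finset (EuclideanSpace ℝ (Fin d)), (T : Set (EuclideanSpace ℝ (Fin d))) ⊆ A →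
      T.card = d + 1 → ∀ (u : EuclideanSpace ℝ (Fin d)) (c : ℝ), u ≠ 0 →
        ¬ (T : Set (EuclideanSpace ℝ (Fin d))) ⊆ hyperplane u c) ∧
  (∀ T : Finset (EuclideanSpace ℝ (Fin d)), (T : Set (EuclideanSpace ℝ (Fin d))) ⊆ A →
      T.card = d + 2 → ∀ (z : EuclideanSpace ℝ (Fin d)) (r : ℝ), 0 < r →
        ¬ (T : Set (EuclideanSpace ℝ (Fin d))) ⊆ Metric.sphere z r)

open Classical in
/-- `D` is a `k`-facet of the finite set `A ⊆ ℝᵈ`: a subset of `d` points of `A` such that a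
hyperplane through the points of `D` partitions `A \ D` into `k` points on one side and
`|A| - d - k` points on the other side. (As `(u, c)` may be replaced by `(-u, -c)`, which
of the two sides carries the `k` points is irrelevant.) -/
def IsFacet {d : ℕ} (A : Finset (EuclideanSpace ℝ (Fin d))) (k : ℕ)
    (D : Finset (EuclideanSpace ℝ (Fin d))) : Prop :=
  D ⊆ A ∧ D.card = d ∧
    ∃ (u : EuclideanSpace ℝ (Fin d)) (c : ℝ), u ≠ 0 ∧
      (D : Set (EuclideanSpace ℝ (Fin d))) ⊆ hyperplane u c ∧
      ((A \ D).filter (fun a => inner ℝ u a < c)).card = k ∧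
      k + ((A \ D).filter (fun a => c < inner ℝ u a)).card + d = A.card

open Classical in
/-- `F_k(A)`, the number of `k`-facets of `A`. -/
def numFacets {d : ℕ} (A : Finset (EuclideanSpace ℝ (Fin d))) (k : ℕ) : ℕ :=
  (A.powerset.filter (fun D => IsFacet A k D)).card

end FacetCount

end

namespace FacetCount

open Finset

/-! Direct each line through two points of `A` so that the smaller count `j ≤ k` lies on its right.
Three such lines have at most `3k` points on their right sides, so at least 3 of the `n ≥ 3k + 3`
points lie weakly left of all three lines, and their centroid lies strictly left. By Helly, one
point `o` is strictly left of every directed line (`exists_forall_orient_pos`). Fix the head `q`.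
All tails lie on one side of the line `q o`; the line from the tail nearest in angle to the ray `q
o` has all other tails on its right, so there are at most `k + 1` tails (`card_le_of_orient_pos`).
Summing over `q` gives `(k + 1) n`. -/

/-- Twice the signed area of the triangle `p q x`; it is positive iff `x` lies to the left
of the line directed from `p` to `q`. -/
def orient (p q x : EuclideanSpace ℝ (Fin 2)) : ℝ :=
  (q 0 - p 0) * (x 1 - p 1) - (q 1 - p 1) * (x 0 - p 0)

lemma orient_left (p q : EuclideanSpace ℝ (Fin 2)) : orient p q p = 0 := by
  simp [orient]

lemma orient_right (p q : EuclideanSpace ℝ (Fin 2)) : orient p q q = 0 := by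
  simp only [orient]; ring

lemma orient_self (p x : EuclideanSpace ℝ (Fin 2)) : orient p p x = 0 := by
  simp [orient]

lemma orient_affine (p q x y : EuclideanSpace ℝ (Fin 2)) {a b : ℝ} (hab : a + b = 1) :
    orient p q (a • x + b • y) = a * orient p q x + b * orient p q y := by
  obtain rfl : b = 1 - a := by linarith
  simp only [orient, PiLp.add_apply, PiLp.smul_apply, smul_eq_mul]; ring

lemma orient_centroid (p q x y z : EuclideanSpace ℝ (Fin 2)) :
    orient p q ((1 / 3 : ℝ) • (x + y + z)) =
      (orient p q x + orient p q y + orient p q z) / 3 := by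
  simp only [orient, PiLp.add_apply, PiLp.smul_apply, smul_eq_mul]; ring

lemma convex_orient_pos (p q : EuclideanSpace ℝ (Fin 2)) : Convex ℝ {x | 0 < orient p q x} := by
  intro x hx y hy a b ha hb hab
  simp only [Set.mem_ofPred_eq] at hx hy ⊢
  rw [orient_affine p q x y hab]
  rcases ha.eq_or_lt with rfl | ha
  · obtain rfl : b = 1 := by linarith
    simpa using hy
  · have := mul_pos ha hx
    have := mul_nonneg hb hy.le
    linarith

lemma inner_fin_two (u x : EuclideanSpace ℝ (Fin 2)) :
    inner ℝ u x = u 0 * x 0 + u 1 * x 1 := by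
  simp [PiLp.inner_apply, Fin.sum_univ_two, mul_comm]

lemma Generic.orient_ne_zero {A : Set (EuclideanSpace ℝ (Fin 2))} (hA : Generic A)
    {x y z : EuclideanSpace ℝ (Fin 2)} (hx : x ∈ A) (hy : y ∈ A) (hz : z ∈ A)
    (hxy : x ≠ y) (hxz : x ≠ z) (hyz : y ≠ z) : orient x y z ≠ 0 := by
  classical
  intro h
  -- A quarter turn of `y - x`, hence a normal of the line through `x` and `y`.
  let u : EuclideanSpace ℝ (Fin 2) := !₂[-(y 1 - x 1), y 0 - x 0]
  have hu : u ≠ 0 := by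
    intro hu
    have h0 : u 0 = 0 := by rw [hu]; rfl
    have h1 : u 1 = 0 := by rw [hu]; rfl
    simp only [u, Matrix.cons_val_zero, Matrix.cons_val_one] at h0 h1
    apply hxy
    ext i
    fin_cases i
    · simp only [Fin.zero_eta]; linarith
    · simp only [Fin.mk_one]; linarith
  refine hA.1 {x, y, z} ?_ (card_eq_three.2 ⟨x, y, z, hxy, hxz, hyz, rfl⟩) u (inner ℝ u x) hu ?_
  · intro t ht
    simp only [coe_insert, coe_singleton, Set.mem_insert_iff, Set.mem_singleton_iff] at ht
    rcases ht with rfl | rfl | rfl <;> assumption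
  · intro t ht
    simp only [coe_insert, coe_singleton, Set.mem_insert_iff, Set.mem_singleton_iff] at ht
    simp only [orient] at h
    simp only [hyperplane, Set.mem_ofPred_eq, inner_fin_two, u,
      Matrix.cons_val_zero, Matrix.cons_val_one]
    rcases ht with rfl | rfl | rfl
    · rfl
    · ring
    · linarith

/-! ### Facets as directed pairs -/

open Classical in
/-- The points of `A` strictly to the right of the line directed from `p` to `q`. -/
noncomputable def rightSide (A : Finset (EuclideanSpace ℝ (Fin 2))) (p q : EuclideanSpace ℝ (Fin 2)) :
    Finset (EuclideanSpace ℝ (Fin 2)) :=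
  A.filter fun x => orient p q x < 0

lemma mem_rightSide {A : Finset (EuclideanSpace ℝ (Fin 2))} {p q x : EuclideanSpace ℝ (Fin 2)} :
    x ∈ rightSide A p q ↔ x ∈ A ∧ orient p q x < 0 := by
  simp [rightSide]

/-- If `u` is orthogonal to `q - p`, then `u` is a multiple of the normal of the line `p q`. -/
lemma normSq_mul_inner_sub {u p q : EuclideanSpace ℝ (Fin 2)} {c : ℝ}
    (hp : inner ℝ u p = c) (hq : inner ℝ u q = c) (x : EuclideanSpace ℝ (Fin 2)) :
    ((q 0 - p 0) ^ 2 + (q 1 - p 1) ^ 2) * (inner ℝ u x - c) =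
      (u 1 * (q 0 - p 0) - u 0 * (q 1 - p 1)) * orient p q x := by
  have h : u 0 * (q 0 - p 0) + u 1 * (q 1 - p 1) = 0 := by
    rw [inner_fin_two] at hp hq; linarith
  rw [← hp]
  simp only [inner_fin_two, orient]
  linear_combination ((q 0 - p 0) * (x 0 - p 0) + (q 1 - p 1) * (x 1 - p 1)) * h

lemma normSq_sub_pos {p q : EuclideanSpace ℝ (Fin 2)} (h : p ≠ q) :
    0 < (q 0 - p 0) ^ 2 + (q 1 - p 1) ^ 2 := by
  by_contra! hle
  apply h
  have h0 : q 0 - p 0 = 0 := by nlinarith [sq_nonneg (q 0 - p 0), sq_nonneg (q 1 - p 1)]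
  have h1 : q 1 - p 1 = 0 := by nlinarith [sq_nonneg (q 0 - p 0), sq_nonneg (q 1 - p 1)]
  ext i
  fin_cases i
  · simp only [Fin.zero_eta]; linarith
  · simp only [Fin.mk_one]; linarith

/-- By `hpos`, `u` is a positive multiple of the left normal of `q - p`, so `inner ℝ u x - c` and
`orient p q x` have the same sign. -/
lemma rightSide_eq_of_pos {A : Finset (EuclideanSpace ℝ (Fin 2))}
    {u p q : EuclideanSpace ℝ (Fin 2)} {c : ℝ} (hpq : p ≠ q)
    (hp : inner ℝ u p = c) (hq : inner ℝ u q = c)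
    (hpos : 0 < u 1 * (q 0 - p 0) - u 0 * (q 1 - p 1))
    {D : Finset (EuclideanSpace ℝ (Fin 2))} (hD : ∀ x, x ∈ D ↔ x = p ∨ x = q)
    [DecidableEq (EuclideanSpace ℝ (Fin 2))] [DecidablePred fun a => inner ℝ u a < c] :
    (A \ D).filter (fun a => inner ℝ u a < c) = rightSide A p q := by
  have key : ∀ x, inner ℝ u x < c ↔ orient p q x < 0 := by
    intro x
    have h := normSq_mul_inner_sub hp hq x
    have hn := normSq_sub_pos hpq
    constructor
    · intro hx
      by_contra! h0
      have := mul_nonneg hpos.le h0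
      have := mul_neg_of_pos_of_neg hn (sub_neg.2 hx)
      linarith
    · intro hx
      by_contra! h0
      have := mul_nonneg hn.le (sub_nonneg.2 h0)
      have := mul_neg_of_pos_of_neg hpos hx
      linarith
  ext x
  simp only [mem_filter, mem_sdiff, mem_rightSide, key, hD, not_or]
  constructor
  · exact fun h => ⟨h.1.1, h.2⟩
  · refine fun h => ⟨⟨h.1, ?_, ?_⟩, h.2⟩
    · rintro rfl; simp [orient_left] at h
    · rintro rfl; simp [orient_right] at h

open Classical in
-- The order of the two points is chosen so that the side with `j` points becomes the right one.
lemma IsFacet.exists_rightSide {A D : Finset (EuclideanSpace ℝ (Fin 2))} {j : ℕ}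
    (h : IsFacet A j D) :
    ∃ p ∈ A, ∃ q ∈ A, p ≠ q ∧ D = {p, q} ∧ (rightSide A p q).card = j := by
  obtain ⟨hDA, hD2, u, c, hu, hDu, hj, -⟩ := h
  obtain ⟨p, q, hpq, rfl⟩ := card_eq_two.1 hD2
  have hpA : p ∈ A := hDA (by simp)
  have hqA : q ∈ A := hDA (by simp)
  have hp : inner ℝ u p = c := hDu (by simp)
  have hq : inner ℝ u q = c := hDu (by simp)
  -- Otherwise `u` is orthogonal both to `q - p` and to its quarter turn, which forces `u = 0`.
  have hne : u 1 * (q 0 - p 0) - u 0 * (q 1 - p 1) ≠ 0 := by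
    intro h0
    have hsq : inner ℝ u u = 0 := by
      have hn := normSq_sub_pos hpq
      have ho : u 0 * (q 0 - p 0) + u 1 * (q 1 - p 1) = 0 := by
        rw [inner_fin_two] at hp hq; linarith
      have : ((q 0 - p 0) ^ 2 + (q 1 - p 1) ^ 2) * inner ℝ u u = 0 := by
        rw [inner_fin_two]
        linear_combination (u 0 * (q 0 - p 0) + u 1 * (q 1 - p 1)) * ho +
          (u 1 * (q 0 - p 0) - u 0 * (q 1 - p 1)) * h0
      exact (mul_eq_zero.1 this).resolve_left hn.ne'
    exact hu (inner_self_eq_zero.1 hsq)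
  rcases hne.lt_or_gt with hneg | hpos
  · refine ⟨q, hqA, p, hpA, hpq.symm, pair_comm p q, ?_⟩
    rw [← rightSide_eq_of_pos (A := A) hpq.symm hq hp (by linarith) (D := {p, q})
      (by simp [or_comm])]
    exact hj
  · refine ⟨p, hpA, q, hqA, hpq, rfl, ?_⟩
    rw [← rightSide_eq_of_pos (A := A) hpq hp hq hpos (D := {p, q}) (by simp)]
    exact hj

open Classical in
/-- The ordered pairs of distinct points of `A` with at most `k` points of `A` to the right. -/
noncomputable def shallowPairs (A : Finset (EuclideanSpace ℝ (Fin 2))) (k : ℕ) :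
    Finset (EuclideanSpace ℝ (Fin 2) × EuclideanSpace ℝ (Fin 2)) :=
  (A ×ˢ A).filter fun e => e.1 ≠ e.2 ∧ (rightSide A e.1 e.2).card ≤ k

lemma mem_shallowPairs {A : Finset (EuclideanSpace ℝ (Fin 2))} {k : ℕ}
    {e : EuclideanSpace ℝ (Fin 2) × EuclideanSpace ℝ (Fin 2)} :
    e ∈ shallowPairs A k ↔
      (e.1 ∈ A ∧ e.2 ∈ A) ∧ e.1 ≠ e.2 ∧ (rightSide A e.1 e.2).card ≤ k := by
  simp [shallowPairs]

open Classical in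
-- Among the shallow pairs with exactly `j` points on the right, forgetting the order reaches every
-- `j`-facet.
lemma sum_numFacets_le_card_shallowPairs (A : Finset (EuclideanSpace ℝ (Fin 2))) (k : ℕ) :
    ∑ j ∈ range (k + 1), numFacets A j ≤ (shallowPairs A k).card := by
  rw [card_eq_sum_card_fiberwise (f := fun e => (rightSide A e.1 e.2).card)
    (t := range (k + 1))]
  · refine sum_le_sum fun j hj => ?_
    refine le_trans (card_le_card ?_)
      (card_image_le (f := fun e : EuclideanSpace ℝ (Fin 2) × EuclideanSpace ℝ (Fin 2) =>
        ({e.1, e.2} : Finset _)))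
    intro D hD
    obtain ⟨p, hp, q, hq, hpq, rfl, hc⟩ := (mem_filter.1 hD).2.exists_rightSide
    refine mem_image.2 ⟨(p, q), mem_filter.2 ⟨mem_shallowPairs.2 ⟨⟨hp, hq⟩, hpq, ?_⟩, hc⟩, rfl⟩
    have := mem_range.1 hj
    simp only [hc]; omega
  · intro e he
    have := (mem_shallowPairs.1 (mem_coe.1 he)).2.2
    simp only [coe_range, Set.mem_Iio]; omega

/-! ### A common left point by Helly's theorem -/

/-- Some point lies strictly to the left of all pairs with few points on their right. -/
lemma exists_forall_orient_pos {A : Finset (EuclideanSpace ℝ (Fin 2))} {k : ℕ}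
    (hA : Generic (A : Set (EuclideanSpace ℝ (Fin 2)))) (hk : 3 * k + 3 ≤ A.card) :
    ∃ o, ∀ e ∈ shallowPairs A k, 0 < orient e.1 e.2 o := by
  classical
  have := Convex.helly_theorem' (𝕜 := ℝ) (s := shallowPairs A k)
    (F := fun e => {x | 0 < orient e.1 e.2 x}) (fun e _ => convex_orient_pos e.1 e.2) ?_
  · obtain ⟨o, ho⟩ := this
    exact ⟨o, fun e he => Set.mem_iInter₂.1 ho e he⟩
  intro I hI hI3
  rw [finrank_euclideanSpace_fin] at hI3
  have hbad : (I.biUnion fun e => rightSide A e.1 e.2).card ≤ 3 * k :=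
    (card_biUnion_le_card_mul _ _ k fun e he => (mem_shallowPairs.1 (hI he)).2.2).trans
      (Nat.mul_le_mul_right k hI3)
  have hgood : 3 ≤ (A \ I.biUnion fun e => rightSide A e.1 e.2).card := by
    have := le_card_sdiff (I.biUnion fun e => rightSide A e.1 e.2) A
    omega
  obtain ⟨T, hT, hT3⟩ := exists_subset_card_eq hgood
  obtain ⟨x, y, z, hxy, hxz, hyz, rfl⟩ := card_eq_three.1 hT3
  -- All three points are weakly left of each line of `I`. By genericity at most two of them are on
  -- it, so the centroid is strictly left.
  refine ⟨(1 / 3 : ℝ) • (x + y + z), Set.mem_iInter₂.2 fun e he => ?_⟩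
  simp only [Set.mem_ofPred_eq, orient_centroid]
  have hnn : ∀ t ∈ ({x, y, z} : Finset _), t ∈ A ∧ 0 ≤ orient e.1 e.2 t := by
    intro t ht
    have h := mem_sdiff.1 (hT ht)
    refine ⟨h.1, not_lt.1 fun hlt => h.2 (mem_biUnion.2 ⟨e, he, mem_rightSide.2 ⟨h.1, hlt⟩⟩)⟩
  obtain ⟨⟨hp, hq⟩, hpq, -⟩ := mem_shallowPairs.1 (hI he)
  have hon : ∀ t ∈ ({x, y, z} : Finset _), orient e.1 e.2 t = 0 → t ∈ ({e.1, e.2} : Finset _) := by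
    intro t ht h0
    by_contra hne
    simp only [mem_insert, mem_singleton, not_or] at hne
    exact hA.orient_ne_zero hp hq (hnn t ht).1 hpq (Ne.symm hne.1) (Ne.symm hne.2) h0
  have hx := (hnn x (by simp)).2
  have hy := (hnn y (by simp)).2
  have hz := (hnn z (by simp)).2
  by_contra! hle
  have hsub : ({x, y, z} : Finset _) ⊆ {e.1, e.2} := by
    intro t ht
    refine hon t ht ?_
    simp only [mem_insert, mem_singleton] at ht
    rcases ht with rfl | rfl | rfl <;> linarith
  have := (card_le_card hsub).trans card_le_two
  omega

/-! ### Counting pairs with a fixed head -/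

/-- The points `p` seen from `q` on one side of the line `q o` are linearly ordered by angle,
and all but the first of them lie to the right of the line from the first one to `q`. -/
lemma card_le_of_orient_pos {A S : Finset (EuclideanSpace ℝ (Fin 2))} {k : ℕ}
    (hA : Generic (A : Set (EuclideanSpace ℝ (Fin 2)))) (hS : S ⊆ A)
    {o q : EuclideanSpace ℝ (Fin 2)} (hq : q ∈ A) (ho : ∀ p ∈ S, 0 < orient p q o)
    (hk : ∀ p ∈ S, (rightSide A p q).card ≤ k) : S.card ≤ k + 1 := by
  classical
  rcases S.eq_empty_or_nonempty with rfl | hne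
  · simp
  -- The ratio is the cotangent of the angle at `q` from `o` to `x`, which lies in `(0, π)`; its
  -- maximum gives the smallest angle.
  obtain ⟨p, hp, hmax⟩ := exists_max_image S
    (fun x => ((o 0 - q 0) * (x 0 - q 0) + (o 1 - q 1) * (x 1 - q 1)) / orient x q o) hne
  have hneq : ∀ x ∈ S, x ≠ q := by
    rintro x hx rfl
    simpa [orient_self] using ho x hx
  have hsub : S.erase p ⊆ rightSide A p q := by
    intro x hx
    obtain ⟨hxp, hxS⟩ := mem_erase.1 hx
    refine mem_rightSide.2 ⟨hS hxS, lt_of_le_of_ne ?_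
      (hA.orient_ne_zero (hS hp) hq (hS hxS) (hneq p hp) hxp.symm (hneq x hxS).symm)⟩
    have hle := hmax x hxS
    rw [div_le_div_iff₀ (ho x hxS) (ho p hp)] at hle
    have hoq : o ≠ q := by
      rintro rfl
      simpa [orient_right] using ho p hp
    have hn := normSq_sub_pos hoq.symm
    -- Contradicts the identity `|o - q|² * orient p q x = ⟨o - q, x - q⟩ * orient p q o - ⟨o - q, p
    -- - q⟩ * orient x q o`, whose right side is at most 0 by `hle`.
    by_contra! hpos
    have := mul_pos hn hpos
    simp only [orient] at hle this
    linarith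
  have h1 := (card_le_card hsub).trans (hk p hp)
  rw [card_erase_of_mem hp] at h1
  omega

lemma card_shallowPairs_le {A : Finset (EuclideanSpace ℝ (Fin 2))} {k : ℕ}
    (hA : Generic (A : Set (EuclideanSpace ℝ (Fin 2)))) (hk : 3 * k + 3 ≤ A.card) :
    (shallowPairs A k).card ≤ (k + 1) * A.card := by
  classical
  obtain ⟨o, ho⟩ := exists_forall_orient_pos hA hk
  refine card_le_mul_card_image_of_maps_to (f := Prod.snd)
    (fun e he => (mem_shallowPairs.1 he).1.2) (k + 1) fun q hq => ?_
  have hinj : Set.InjOn Prod.fst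
      {e | e ∈ (shallowPairs A k).filter fun e => e.2 = q} := by
    intro a ha b hb hab
    exact Prod.ext hab ((mem_filter.1 ha).2.trans (mem_filter.1 hb).2.symm)
  rw [← card_image_of_injOn hinj]
  have hmem : ∀ p ∈ ((shallowPairs A k).filter fun e => e.2 = q).image Prod.fst,
      (p, q) ∈ shallowPairs A k := by
    intro p hp
    obtain ⟨⟨a, b⟩, he, rfl⟩ := mem_image.1 hp
    obtain ⟨hmem, rfl⟩ := mem_filter.1 he
    exact hmem
  exact card_le_of_orient_pos hA (fun p hp => (mem_shallowPairs.1 (hmem p hp)).1.1) hq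
    (fun p hp => ho _ (hmem p hp)) (fun p hp => (mem_shallowPairs.1 (hmem p hp)).2.2)

end FacetCount

theorem proposition4p1 (n k : ℕ) (A : Finset (EuclideanSpace ℝ (Fin 2)))
    (hA : FacetCount.Generic (A : Set (EuclideanSpace ℝ (Fin 2)))) (hn : A.card = n)
    (hk : (k : ℝ) ≤ ((n : ℝ) - 3) / 3) :
    ∑ j ∈ Finset.range (k + 1), FacetCount.numFacets A j ≤ (k + 1) * n := by
  subst hn
  have hk' : 3 * k + 3 ≤ A.card := by
    have : (3 * k + 3 : ℝ) ≤ A.card := by linarith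
    exact_mod_cast this
  exact (FacetCount.sum_numFacets_le_card_shallowPairs A k).trans
    (FacetCount.card_shallowPairs_le hA hk')
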